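/- Let $S=K[x_1,\dots,x_n]$ be the standard graded polynomial ring over a field $K$. A discrete polymatroid is a nonempty finite set $\mathcal P\subset\mathbb Z_{\ge 0}^n$ such that (i) if $u\in\mathcal P$ and $v\in\mathbb Z_{\ge0}^n$ with $v\le u$ componentwise, then $v\in\mathcal P$, and (ii) if $u,v\in\mathcal P$ and $u_1+\cdots+u_n<v_1+\cdots+v_n$, then there is an $i$ with $u_i<v_i$ such that $u+e_i\in\mathcal P$, where $e_i$ is the $i$-th unit vector; its bases are its maximal elements. A monomial ideal $I\subseteq S$ is called polymatroidal if the exponent vectors of its minimal monomial generators form the set of bases of a discrete polymatroid; the zero ideal is regarded as polymatroidal too. A polymatroidal ideal is called matroidal if its minimal monomial generators are squarefree. For $k\ge 1$ let $$I^{(k)}=\bigcap_{P\in\operatorname{Ass}(S/I)}\bigl(I^kS_P\cap S\bigr)$$ be the $k$-th symbolic power of $I$, and for a graded ideal $J\subseteq S$ let $\operatorname{reg} J$ be its Castelnuovo-Mumford regularity, i.e. if $\cdots\to F_1\to F_0\to J\to 0$ with $F_i=\bigoplus_{b}S(-a_{i,b})$ is the minimal graded free resolution of $J$, then $\operatorname{reg}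 J=\max_{i,b}\{a_{i,b}-i\}$ (with $\operatorname{reg}(0)=-\infty$). Let $I\subseteq S$ be a polymatroidal ideal without embedded associated primes, that is, every $P\in\operatorname{Ass}(S/I)$ is a minimal prime of $I$. Then $$\operatorname{reg} I^{(k)}\ \ge\ \operatorname{reg} I^{k}\qquad\text{for all } k\ge 1.$$ Moreover, every matroidal ideal has no embedded associated primes, so that the inequality holds in particular for all matroidal ideals. -/

import Mathlib

/-- The `k`-th symbolic power of an ideal `I` of a (Noetherian) ring `R`: the intersection, over
the associated primes `P` of `R ⧸ I`, of the contractions to `R` of `I ^ k R_P`. -/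
noncomputable def symbolicPower {R : Type*} [CommRing R] (I : Ideal R) (k : ℕ) : Ideal R :=
  ⨅ P : associatedPrimes R (R ⧸ I),
    ((I ^ k).map (algebraMap R (Localization.AtPrime P.1))).comap
      (algebraMap R (Localization.AtPrime P.1))

/-- `I` has no embedded associated primes: every associated prime of `R ⧸ I` is a minimal prime
of `I`. -/
def HasNoEmbeddedPrimes {R : Type*} [CommRing R] (I : Ideal R) : Prop :=
  ∀ P ∈ associatedPrimes R (R ⧸ I), P ∈ I.minimalPrimes

/-- A discrete polymatroid on the ground set `Fin n`: a nonempty finite set of vectors with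
nonnegative integer entries which is closed under passing to smaller vectors and in which a vector
of smaller modulus can be augmented from any vector of larger modulus. -/
structure IsDiscretePolymatroid {n : ℕ} (P : Set (Fin n →₀ ℕ)) : Prop where
  nonempty : P.Nonempty
  finite : P.Finite
  mem_of_le : ∀ u ∈ P, ∀ v, v ≤ u → v ∈ P
  augment : ∀ u ∈ P, ∀ v ∈ P, u.degree < v.degree →
    ∃ i, u i < v i ∧ u + Finsupp.single i 1 ∈ P

/-- The bases of a discrete polymatroid: its maximal vectors. -/
def polymatroidBases {n : ℕ} (P : Set (Fin n →₀ ℕ)) : Set (Fin n →₀ ℕ) :=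
  {u | Maximal (· ∈ P) u}

/-- A monomial ideal: an ideal generated by monomials. -/
def IsMonomialIdeal {n : ℕ} {K : Type*} [Field K] (I : Ideal (MvPolynomial (Fin n) K)) : Prop :=
  ∃ A : Set (Fin n →₀ ℕ), I = Ideal.span ((fun a => MvPolynomial.monomial a (1 : K)) '' A)

/-- The exponent vectors of the minimal monomial generators of a monomial ideal, that is, of the
monomials of `I` that are minimal with respect to divisibility. -/
def minimalExponents {n : ℕ} {K : Type*} [Field K] (I : Ideal (MvPolynomial (Fin n) K)) :
    Set (Fin n →₀ ℕ) :=
  {a | Minimal (fun b => MvPolynomial.monomial b (1 : K) ∈ I) a}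

/-- A polymatroidal ideal: a monomial ideal such that the exponent vectors of its minimal monomial
generators form the set of bases of a discrete polymatroid. The zero ideal is regarded as
polymatroidal too. -/
def IsPolymatroidal {n : ℕ} {K : Type*} [Field K] (I : Ideal (MvPolynomial (Fin n) K)) : Prop :=
  I = ⊥ ∨ (IsMonomialIdeal I ∧
    ∃ P : Set (Fin n →₀ ℕ), IsDiscretePolymatroid P ∧ minimalExponents I = polymatroidBases P)

/-- A matroidal ideal: a polymatroidal ideal whose minimal monomial generators are squarefree. -/
def IsMatroidal {n : ℕ} {K : Type*} [Field K] (I : Ideal (MvPolynomial (Fin n) K)) : Prop :=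
  IsPolymatroidal I ∧ ∀ a ∈ minimalExponents I, ∀ i, a i ≤ 1

/-- A graded free resolution `⋯ → F₁ → F₀ → I → 0` of a graded ideal `I` of the standard graded
polynomial ring `S = K[x₁, …, xₙ]` by finitely generated graded free modules.
The module `F i` is free on the finite set `B i`, and the basis element `b` has degree `deg i b`,
that is, `F i = ⨁ b, S(-deg i b)`. The maps are homogeneous of degree `0`: they are matrices each
of whose entries is a form of the degree dictated by the degrees of the basis elements (in
particular the entry is zero when this degree is negative). -/
structure GradedFreeResolution {n : ℕ} {K : Type*} [Field K]
    (I : Ideal (MvPolynomial (Fin n) K)) where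
  /-- the basis of the `i`-th free module -/
  B : ℕ → Type
  finite : ∀ i, Finite (B i)
  /-- the degrees of the basis elements -/
  deg : ∀ i, B i → ℤ
  /-- the differential -/
  d : ∀ i, (B (i + 1) →₀ MvPolynomial (Fin n) K) →ₗ[MvPolynomial (Fin n) K]
    (B i →₀ MvPolynomial (Fin n) K)
  /-- the augmentation `F₀ → I ⊆ S` -/
  aug : (B 0 →₀ MvPolynomial (Fin n) K) →ₗ[MvPolynomial (Fin n) K] MvPolynomial (Fin n) K
  aug_homogeneous : ∀ b, ∀ e ∈ (aug (Finsupp.single b 1)).support, (e.degree : ℤ) = deg 0 b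
  d_homogeneous : ∀ i b c, ∀ e ∈ (d i (Finsupp.single b 1) c).support,
    (e.degree : ℤ) = deg (i + 1) b - deg i c
  range_aug : LinearMap.range aug = I
  exact_zero : LinearMap.ker aug = LinearMap.range (d 0)
  exact_succ : ∀ i, LinearMap.ker (d i) = LinearMap.range (d (i + 1))

/-- A graded free resolution is minimal if `d (F (i + 1)) ⊆ 𝔪 F i` for all `i`, that is, if all
entries of the matrices of the differentials lie in `𝔪 = (x₁, …, xₙ)`. -/
def GradedFreeResolution.IsMinimal {n : ℕ} {K : Type*} [Field K]
    {I : Ideal (MvPolynomial (Fin n) K)} (F : GradedFreeResolution I) : Prop :=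
  ∀ i b c, F.d i (Finsupp.single b 1) c ∈
    Ideal.span (Set.range (MvPolynomial.X : Fin n → MvPolynomial (Fin n) K))

/-- The Castelnuovo-Mumford regularity of a graded ideal `I`: the maximum of `j - i` over all
`i, j` such that `S(-j)` is a direct summand of the `i`-th module of the minimal graded free
resolution of `I`. The minimal graded free resolution of `I` exists and is unique up to
isomorphism, so that the outer infimum is over copies of one and the same value. The value is an
integer, except that the zero ideal has regularity `-∞`. -/
noncomputable def regularity {n : ℕ} {K : Type*} [Field K]
    (I : Ideal (MvPolynomial (Fin n) K)) : EReal :=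
  ⨅ (F : GradedFreeResolution I) (_ : F.IsMinimal),
    ⨆ (i : ℕ) (b : F.B i), (((F.deg i b - (i : ℤ) : ℤ) : ℝ) : EReal)

/-! Both regularities are compared with the number `k * d`, where `d` is the common degree of the
generators of `I` and `B` is the set of their exponents.

Upper bound: `B` has the exchange property, which passes to sums of sets, so `I ^ k` is again
generated by an exchange set, in degree `k * d`. In lexicographic order such generators have linear
quotients: the colon of each by the span of the earlier ones is generated by variables. The
resulting linear syzygies form a sequence of the same kind, so iteration gives a linear minimal
resolution. As `regularity` is an infimum over minimal resolutions, this one gives `regularity (I ^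
k) ≤ k * d`.

Lower bound: for `u ∈ B` the monomial with exponent `k • u` is a minimal generator of the symbolic
power, so every graded resolution has a generator of degree `k * d`. For each `i` in the support of
`u`, absence of embedded primes yields an associated prime, generated by the variables in a set `T ∋
i`, such that `u` has least weight on `T` among all of `B`. Exponents in the symbolic power have
weight at least `k` times that minimum on `T`, and lowering coordinate `i` of `k • u` would violate
this.

A matroidal ideal is radical, hence a finite intersection of its minimal primes, and so has no
embedded primes. -/

/-- The one-sided basis exchange property for a set of exponent vectors. -/
def HasExchange {n : ℕ} (B : Set (Fin n →₀ ℕ)) : Prop :=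
  ∀ u ∈ B, ∀ v ∈ B, ∀ s, v s < u s → ∃ p, u p < v p ∧
    ∃ w ∈ B, w + Finsupp.single s 1 = u + Finsupp.single p 1

/-! ### Exchange properties of polymatroid bases and their sums. -/

section Combinatorics

variable {n : ℕ}

theorem IsDiscretePolymatroid.degree_le {P : Set (Fin n →₀ ℕ)} (hP : IsDiscretePolymatroid P)
    {u v : Fin n →₀ ℕ} (hu : u ∈ polymatroidBases P) (hv : v ∈ P) : v.degree ≤ u.degree := by
  by_contra! h
  obtain ⟨i, -, hi⟩ := hP.augment u hu.1 v hv h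
  have h1 := hu.2 hi (le_self_add) i
  simp at h1

theorem IsDiscretePolymatroid.degree_eq {P : Set (Fin n →₀ ℕ)} (hP : IsDiscretePolymatroid P)
    {u v : Fin n →₀ ℕ} (hu : u ∈ polymatroidBases P) (hv : v ∈ polymatroidBases P) :
    v.degree = u.degree :=
  le_antisymm (hP.degree_le hu hv.1) (hP.degree_le hv hu.1)

theorem IsDiscretePolymatroid.mem_bases {P : Set (Fin n →₀ ℕ)} (hP : IsDiscretePolymatroid P)
    {u v : Fin n →₀ ℕ} (hu : u ∈ polymatroidBases P) (hv : v ∈ P) (h : v.degree = u.degree) :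
    v ∈ polymatroidBases P := by
  obtain ⟨w, hvw, hw⟩ := hP.finite.exists_le_maximal hv
  have h1 : w.degree = v.degree := (hP.degree_eq hu hw).trans h.symm
  obtain ⟨c, rfl⟩ := exists_add_of_le hvw
  rw [map_add, Nat.add_eq_left, Finsupp.degree_eq_zero_iff] at h1
  subst h1
  rwa [add_zero] at hw

/-- Removing one unit at `s` from `u` leaves a vector of smaller modulus than `v`; augmenting it
from `v` gives a basis, since all bases have the same modulus. -/
theorem IsDiscretePolymatroid.hasExchange {P : Set (Fin n →₀ ℕ)} (hP : IsDiscretePolymatroid P) :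
    HasExchange (polymatroidBases P) := by
  intro u hu v hv s hs
  have hle : Finsupp.single s 1 ≤ u := by
    rw [Finsupp.single_le_iff]; omega
  obtain ⟨c, rfl⟩ := exists_add_of_le hle
  have hc : c ∈ P := hP.mem_of_le _ hu.1 c le_add_self
  have hd := hP.degree_eq hu hv
  rw [map_add, Finsupp.degree_single] at hd
  obtain ⟨p, hp, hcp⟩ := hP.augment c hc v hv.1 (by omega)
  have hps : s ≠ p := by
    rintro rfl
    simp at hs
    omega
  refine ⟨p, by simpa [Finsupp.single_apply, hps] using hp, c + Finsupp.single p 1, ?_, ?_⟩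
  · refine hP.mem_bases hu hcp ?_
    simp [add_comm]
  · abel

theorem sum_tsub_lt_of_exchange {a v w : Fin n →₀ ℕ} {p q : Fin n} (hp : a p < v p)
    (hq : v q < a q) (h : w + Finsupp.single q 1 = a + Finsupp.single p 1) :
    ∑ l, (w l - v l) < ∑ l, (a l - v l) := by
  have hl : ∀ l, w l + (if q = l then 1 else 0) = a l + (if p = l then 1 else 0) := by
    intro l
    simpa [Finsupp.single_apply] using DFunLike.congr_fun h l
  refine Finset.sum_lt_sum (fun l _ => ?_) ⟨q, Finset.mem_univ _, ?_⟩
  · have := hl l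
    by_cases h2 : p = l
    · subst h2; split_ifs at this <;> omega
    · split_ifs at this <;> omega
  · have := hl q
    have hpq : p ≠ q := by rintro rfl; omega
    simp only [if_true, if_neg hpq] at this
    omega

-- An exchange in one summand may add a unit at a coordinate `q` where the total is already large
-- enough. That unit is then removed again by an exchange in whichever summand exceeds its target
-- there, and so on; each exchange brings the pair closer to `(v₁, v₂)`, so the walk ends.
open Pointwise in
theorem HasExchange.add {B C : Set (Fin n →₀ ℕ)} (hB : HasExchange B) (hC : HasExchange C) :
    HasExchange (B + C) := by
  rintro u hu - ⟨v₁, hv₁, v₂, hv₂, rfl⟩ s hs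
  simp only at hs ⊢
  -- Invariant of the walk: `a₁ + a₂` is `u` with one unit moved from `s` to `q`. The start is `q =
  -- s`, and `N` is the total excess over the target.
  suffices H : ∀ N, ∀ a₁ ∈ B, ∀ a₂ ∈ C, ∀ q,
      a₁ + a₂ + Finsupp.single s 1 = u + Finsupp.single q 1 →
      ∑ l, (a₁ l - v₁ l) + ∑ l, (a₂ l - v₂ l) = N →
      ∃ p, u p < (v₁ + v₂) p ∧ ∃ w ∈ B + C, w + Finsupp.single s 1 = u + Finsupp.single p 1 by
    obtain ⟨u₁, hu₁, u₂, hu₂, rfl⟩ := hu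
    exact H _ u₁ hu₁ u₂ hu₂ s rfl rfl
  intro N
  induction N using Nat.strong_induction_on with
  | _ N ih =>
  intro a₁ ha₁ a₂ ha₂ q hq hN
  by_cases hqv : u q < (v₁ + v₂) q
  · exact ⟨q, hqv, a₁ + a₂, Set.add_mem_add ha₁ ha₂, hq⟩
  have hgt : v₁ q + v₂ q < a₁ q + a₂ q := by
    have h1 := DFunLike.congr_fun hq q
    simp only [Finsupp.add_apply, Finsupp.single_eq_same] at h1 hqv hs
    by_cases hsq : s = q
    · subst hsq; simp only [Finsupp.single_eq_same] at h1; omega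
    · rw [Finsupp.single_apply, if_neg hsq] at h1; omega
  rcases lt_or_ge (v₁ q) (a₁ q) with h1 | h1
  · obtain ⟨p, hp, w, hw, hwp⟩ := hB a₁ ha₁ v₁ hv₁ q h1
    have hlt := sum_tsub_lt_of_exchange hp h1 hwp
    refine ih _ (by omega) w hw a₂ ha₂ p ?_ rfl
    apply add_right_cancel (b := Finsupp.single q 1)
    calc _ = (w + Finsupp.single q 1) + (a₂ + Finsupp.single s 1) := by abel
      _ = (a₁ + a₂ + Finsupp.single s 1) + Finsupp.single p 1 := by rw [hwp]; abel
      _ = _ := by rw [hq]; abel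
  · have h2 : v₂ q < a₂ q := by omega
    obtain ⟨p, hp, w, hw, hwp⟩ := hC a₂ ha₂ v₂ hv₂ q h2
    have hlt := sum_tsub_lt_of_exchange hp h2 hwp
    refine ih _ (by omega) a₁ ha₁ w hw p ?_ rfl
    apply add_right_cancel (b := Finsupp.single q 1)
    calc _ = (w + Finsupp.single q 1) + (a₁ + Finsupp.single s 1) := by abel
      _ = (a₁ + a₂ + Finsupp.single s 1) + Finsupp.single p 1 := by rw [hwp]; abel
      _ = _ := by rw [hq]; abel

open Pointwise in
theorem HasExchange.nsmul {B : Set (Fin n →₀ ℕ)} (hB : HasExchange B) (k : ℕ) :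
    HasExchange (k • B) := by
  induction k with
  | zero =>
    rw [zero_nsmul]
    rintro u rfl v rfl s hs
    exact absurd hs (lt_irrefl _)
  | succ k ih => rw [succ_nsmul]; exact ih.add hB

open Pointwise in
theorem degree_eq_of_mem_nsmul {B : Set (Fin n →₀ ℕ)} {d : ℕ} (hB : ∀ u ∈ B, u.degree = d) (k : ℕ)
    {u : Fin n →₀ ℕ} (hu : u ∈ k • B) : u.degree = k * d := by
  induction k generalizing u with
  | zero => rw [zero_nsmul] at hu; rw [Set.mem_zero.1 hu]; simp
  | succ k ih =>
    rw [succ_nsmul] at hu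
    obtain ⟨a, ha, b, hb, rfl⟩ := hu
    rw [map_add, ih ha, hB b hb]; ring

open Pointwise in
theorem span_monomial_pow {K : Type*} [Field K] (B : Set (Fin n →₀ ℕ)) (k : ℕ) :
    Ideal.span ((fun a => MvPolynomial.monomial a (1 : K)) '' B) ^ k =
      Ideal.span ((fun a => MvPolynomial.monomial a (1 : K)) '' (k • B)) := by
  induction k with
  | zero => simp [Ideal.one_eq_top]
  | succ k ih =>
    rw [pow_succ, ih, Ideal.span_mul_span', succ_nsmul]
    congr 1
    ext f
    simp [Set.mem_mul, Set.mem_add]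

end Combinatorics
-- Linear quotients and their syzygies.
section LinearSequences

open MvPolynomial

variable {n : ℕ} {K : Type*} [Field K] {N : Type*} [AddCommGroup N]
  [Module (MvPolynomial (Fin n) K) N] {ι : Type} [LinearOrder ι]

theorem MvPolynomial.homogeneousComponent_mul_of_isHomogeneous {σ R : Type*} [CommRing R]
    {f g : MvPolynomial σ R} {r : ℕ} (hg : g.IsHomogeneous r) (m : ℕ) :
    homogeneousComponent (m + r) (f * g) = homogeneousComponent m f * g := by
  induction f using MvPolynomial.induction_on' with
  | monomial d c =>
    have h1 : (monomial d c * g).IsHomogeneous (d.degree + r) :=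
      (isHomogeneous_monomial c rfl).mul hg
    rw [homogeneousComponent_of_mem (isHomogeneous_monomial c rfl), homogeneousComponent_of_mem h1]
    simp only [add_left_inj]
    split_ifs <;> simp
  | add p q hp hq => rw [add_mul, map_add, hp, hq, map_add, add_mul]

theorem MvPolynomial.mem_span_X_of_mul_X_mem {A : Set (Fin n)} {t : Fin n} (ht : t ∉ A)
    {f : MvPolynomial (Fin n) K} (h : f * X t ∈ Ideal.span (X '' A)) :
    f ∈ Ideal.span (X '' A : Set (MvPolynomial (Fin n) K)) := by
  rw [mem_ideal_span_X_image] at h ⊢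
  intro m hm
  obtain ⟨i, hi, him⟩ := h (m + Finsupp.single t 1) (by simpa using hm)
  refine ⟨i, hi, ?_⟩
  have : t ≠ i := by rintro rfl; exact ht hi
  simpa [Finsupp.single_apply, this] using him

/-- A family with linear quotients: the colon ideal of each member by the span of the earlier ones
is generated by variables, and the corresponding relations have linear forms as coefficients. -/
structure IsLinearSequence (g : ι → N) (T : ι → Set (Fin n)) : Prop where
  rel : ∀ j, ∀ t ∈ T j, ∃ c : ι →₀ MvPolynomial (Fin n) K, (∀ l, (c l).IsHomogeneous 1) ∧
    (∀ l, j ≤ l → c l = 0) ∧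
    (X t : MvPolynomial (Fin n) K) • g j = Finsupp.linearCombination _ g c
  colon : ∀ j, ∀ f : MvPolynomial (Fin n) K,
    f • g j ∈ Submodule.span (MvPolynomial (Fin n) K) (g '' Set.Iio j) →
      f ∈ Ideal.span (X '' T j : Set (MvPolynomial (Fin n) K))

/-- The index set of the linear syzygies of a linear sequence. -/
abbrev SyzygyIndex (T : ι → Set (Fin n)) : Type :=
  {p : ι ×ₗ Fin n // (ofLex p).2 ∈ T (ofLex p).1}

namespace IsLinearSequence

variable {g : ι → N} {T : ι → Set (Fin n)} (h : IsLinearSequence (K := K) g T)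

/-- The coefficients expressing `X t • g j` through earlier members. -/
noncomputable def coeffs (p : SyzygyIndex T) : ι →₀ MvPolynomial (Fin n) K :=
  (h.rel _ _ p.2).choose

/-- The linear syzygies of a linear sequence. -/
noncomputable def syzygy (p : SyzygyIndex T) : ι →₀ MvPolynomial (Fin n) K :=
  Finsupp.single (ofLex p.1).1 (X (ofLex p.1).2) - h.coeffs p

theorem coeffs_isHomogeneous (p : SyzygyIndex T) (l : ι) : (h.coeffs p l).IsHomogeneous 1 :=
  (h.rel _ _ p.2).choose_spec.1 l

theorem coeffs_eq_zero (p : SyzygyIndex T) {l : ι} (hl : (ofLex p.1).1 ≤ l) : h.coeffs p l = 0 :=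
  (h.rel _ _ p.2).choose_spec.2.1 l hl

theorem linearCombination_coeffs (p : SyzygyIndex T) :
    Finsupp.linearCombination _ g (h.coeffs p) =
      (X (ofLex p.1).2 : MvPolynomial (Fin n) K) • g (ofLex p.1).1 :=
  (h.rel _ _ p.2).choose_spec.2.2.symm

theorem syzygy_isHomogeneous (p : SyzygyIndex T) (l : ι) : (h.syzygy p l).IsHomogeneous 1 := by
  refine IsHomogeneous.sub ?_ (h.coeffs_isHomogeneous p l)
  rw [Finsupp.single_apply]
  split_ifs
  · exact isHomogeneous_X _ _
  · exact isHomogeneous_zero _ _ _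

theorem syzygy_mem_ker (p : SyzygyIndex T) :
    h.syzygy p ∈ LinearMap.ker (Finsupp.linearCombination (MvPolynomial (Fin n) K) g) := by
  rw [LinearMap.mem_ker, syzygy, map_sub, linearCombination_coeffs,
    Finsupp.linearCombination_single, sub_self]

theorem syzygy_apply_self (p : SyzygyIndex T) :
    h.syzygy p (ofLex p.1).1 = X (ofLex p.1).2 := by
  simp [syzygy, h.coeffs_eq_zero p le_rfl]

theorem syzygy_apply_of_lt (p : SyzygyIndex T) {l : ι} (hl : (ofLex p.1).1 < l) :
    h.syzygy p l = 0 := by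
  simp [syzygy, h.coeffs_eq_zero p hl.le, hl.ne]

/-- The last coefficient of a relation multiplies `g j` into the span of the earlier members, so the
colon condition applies to it. -/
theorem apply_mem_span_of_mem_ker (h : IsLinearSequence (K := K) g T)
    {v : ι →₀ MvPolynomial (Fin n) K} {j : ι}
    (hv : v ∈ LinearMap.ker (Finsupp.linearCombination (MvPolynomial (Fin n) K) g))
    (hj : ∀ l, j < l → v l = 0) :
    v j ∈ Ideal.span (X '' T j : Set (MvPolynomial (Fin n) K)) := by
  refine h.colon j _ ?_
  rw [← Finsupp.single_add_erase j v, LinearMap.mem_ker, map_add,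
    Finsupp.linearCombination_single, add_eq_zero_iff_eq_neg] at hv
  rw [hv, Submodule.neg_mem_iff, Finsupp.mem_span_image_iff_linearCombination]
  refine ⟨v.erase j, ?_, rfl⟩
  rw [Finsupp.mem_supported]
  intro l hl
  simp only [Finsupp.support_erase, Finset.coe_erase, Set.mem_sdiff, Finset.mem_coe,
    Finsupp.mem_support_iff, Set.mem_singleton_iff] at hl
  exact lt_of_le_of_ne (not_lt.1 fun h' => hl.1 (hj l h')) hl.2

/-- Leading-term reduction: the coefficient at `j` lies in the ideal of the variables of `T j`, so a
combination of the syzygies at `j` cancels it, leaving a relation supported strictly below `j`. -/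
theorem mem_span_syzygy [Finite ι] (j : ι) (v : ι →₀ MvPolynomial (Fin n) K)
    (hv : v ∈ LinearMap.ker (Finsupp.linearCombination (MvPolynomial (Fin n) K) g))
    (hj : ∀ l, j < l → v l = 0) :
    v ∈ Submodule.span (MvPolynomial (Fin n) K)
      (h.syzygy '' {p : SyzygyIndex T | (ofLex p.1).1 ≤ j}) := by
  induction j using WellFoundedLT.induction generalizing v with
  | _ j ih =>
  have key : ∀ f ∈ Ideal.span (X '' T j : Set (MvPolynomial (Fin n) K)),
      ∃ w ∈ Submodule.span (MvPolynomial (Fin n) K)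
        (h.syzygy '' {p : SyzygyIndex T | (ofLex p.1).1 ≤ j}),
        w ∈ LinearMap.ker (Finsupp.linearCombination (MvPolynomial (Fin n) K) g) ∧
        w j = f ∧ ∀ l, j < l → w l = 0 := by
    intro f hf
    induction hf using Submodule.span_induction with
    | mem x hx =>
      obtain ⟨t, ht, rfl⟩ := hx
      let p : SyzygyIndex T := ⟨toLex (j, t), ht⟩
      exact ⟨h.syzygy p, Submodule.subset_span ⟨p, le_rfl, rfl⟩, h.syzygy_mem_ker p,
        h.syzygy_apply_self p, fun l hl => h.syzygy_apply_of_lt p hl⟩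
    | zero => exact ⟨0, zero_mem _, zero_mem _, rfl, fun _ _ => rfl⟩
    | add x y _ _ hx hy =>
      obtain ⟨a, ha, ha', rfl, ha2⟩ := hx
      obtain ⟨b, hb, hb', rfl, hb2⟩ := hy
      exact ⟨a + b, add_mem ha hb, add_mem ha' hb', rfl, fun l hl => by simp [ha2 l hl, hb2 l hl]⟩
    | smul r x _ hx =>
      obtain ⟨a, ha, ha', rfl, ha2⟩ := hx
      exact ⟨r • a, Submodule.smul_mem _ _ ha, Submodule.smul_mem _ _ ha', rfl,
        fun l hl => by simp [ha2 l hl]⟩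
  obtain ⟨w, hw, hwk, hwj, hwl⟩ := key _ (h.apply_mem_span_of_mem_ker hv hj)
  suffices H : v - w ∈ Submodule.span (MvPolynomial (Fin n) K)
      (h.syzygy '' {p : SyzygyIndex T | (ofLex p.1).1 ≤ j}) by
    simpa using add_mem H hw
  by_cases h0 : (v - w).support.Nonempty
  · have hmem := Finset.max'_mem _ h0
    set i := (v - w).support.max' h0 with hi
    have hij : i < j := by
      by_contra hcon
      rcases (not_lt.1 hcon).eq_or_lt with h1 | h1
      · rw [← h1] at hmem
        simp [hwj] at hmem
      · simp [hj _ h1, hwl _ h1] at hmem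
    refine Submodule.span_mono (Set.image_mono ?_) (ih i hij (v - w) (sub_mem hv hwk) ?_)
    · exact fun p hp => le_trans hp hij.le
    · intro l hl
      by_contra hne
      exact absurd (Finset.le_max' _ l (Finsupp.mem_support_iff.2 hne)) (not_le.2 hl)
  · rw [Finset.not_nonempty_iff_eq_empty, Finsupp.support_eq_empty] at h0
    rw [h0]; exact zero_mem _

theorem ker_eq_range_syzygy [Finite ι] :
    LinearMap.ker (Finsupp.linearCombination (MvPolynomial (Fin n) K) g) =
      LinearMap.range (Finsupp.linearCombination (MvPolynomial (Fin n) K) h.syzygy) := by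
  rw [Finsupp.range_linearCombination]
  apply le_antisymm
  · intro v hv
    by_cases h0 : v.support.Nonempty
    · refine Submodule.span_mono (Set.image_subset_range _ _)
        (h.mem_span_syzygy (v.support.max' h0) v hv ?_)
      intro l hl
      by_contra hne
      exact absurd (Finset.le_max' _ l (Finsupp.mem_support_iff.2 hne)) (not_le.2 hl)
    · rw [Finset.not_nonempty_iff_eq_empty, Finsupp.support_eq_empty] at h0
      rw [h0]; exact zero_mem _
  · rw [Submodule.span_le]
    rintro - ⟨p, rfl⟩
    exact h.syzygy_mem_ker p

end IsLinearSequence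

/-- If a vector of forms of degree `m + r` is a combination of vectors of forms of degree `r`, then
the coefficients can be taken to be forms of degree `m`. -/
theorem exists_homogeneous_coeffs {κ μ : Type*} {z : κ → μ →₀ MvPolynomial (Fin n) K} {m r : ℕ}
    (hz : ∀ p l, (z p l).IsHomogeneous r) {A : Set κ} {y : μ →₀ MvPolynomial (Fin n) K}
    (hy : y ∈ Submodule.span (MvPolynomial (Fin n) K) (z '' A))
    (hyh : ∀ l, (y l).IsHomogeneous (m + r)) :
    ∃ c : κ →₀ MvPolynomial (Fin n) K, (∀ p, (c p).IsHomogeneous m) ∧ (∀ p, p ∉ A → c p = 0) ∧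
      y = Finsupp.linearCombination _ z c := by
  rw [Finsupp.mem_span_image_iff_linearCombination] at hy
  obtain ⟨c, hc, rfl⟩ := hy
  refine ⟨c.mapRange (homogeneousComponent m) (map_zero _), fun p => ?_, fun p hp => ?_, ?_⟩
  · rw [Finsupp.mapRange_apply]; exact homogeneousComponent_isHomogeneous _ _
  · rw [Finsupp.mapRange_apply, Finsupp.notMem_support_iff.1 (fun h => hp (hc h)), map_zero]
  · ext1 l
    rw [← homogeneousComponent_eq_self (hyh l), Finsupp.linearCombination_apply,
      Finsupp.linearCombination_apply, Finsupp.sum_mapRange_index (by simp), Finsupp.sum,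
      Finsupp.sum, Finsupp.finsetSum_apply, Finsupp.finsetSum_apply, map_sum]
    refine Finset.sum_congr rfl fun p _ => ?_
    exact homogeneousComponent_mul_of_isHomogeneous (hz p l) m

/-- The syzygies are ordered first by leading index, then by variable. The colon at `(j, t)` is that
of the variables of `T j` smaller than `t` by `X t`, and variables form a regular sequence, so it is
generated by those smaller variables. This lets the construction be iterated. -/
theorem IsLinearSequence.isLinearSequence_syzygy [Finite ι] {g : ι → N} {T : ι → Set (Fin n)}
    (h : IsLinearSequence (K := K) g T) :
    IsLinearSequence (K := K) h.syzygy
      (fun p => {t | t ∈ T (ofLex p.1).1 ∧ t < (ofLex p.1).2}) where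
  rel p t ht := by
    let q : SyzygyIndex T := ⟨toLex ((ofLex p.1).1, t), ht.1⟩
    have hqp : q < p := by
      rw [← Subtype.coe_lt_coe, Prod.Lex.lt_iff]
      exact Or.inr ⟨rfl, ht.2⟩
    -- The Koszul-type combination cancels at the leading index, so it reduces to syzygies with
    -- smaller leading index. Its entries are quadratic and those of the syzygies linear, so the
    -- coefficients can be taken linear.
    let y := (X t : MvPolynomial (Fin n) K) • h.syzygy p -
      (X (ofLex p.1).2 : MvPolynomial (Fin n) K) • h.syzygy q
    have hyk : y ∈ LinearMap.ker (Finsupp.linearCombination (MvPolynomial (Fin n) K) g) :=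
      sub_mem (Submodule.smul_mem _ _ (h.syzygy_mem_ker p))
        (Submodule.smul_mem _ _ (h.syzygy_mem_ker q))
    have hy0 : ∀ l, (ofLex p.1).1 ≤ l → y l = 0 := by
      intro l hl
      rcases hl.eq_or_lt with rfl | hl
      · have h1 := h.syzygy_apply_self p
        have h2 : h.syzygy q (ofLex p.1).1 = X t := h.syzygy_apply_self q
        simp only [y, Finsupp.sub_apply, Finsupp.smul_apply, h1, h2, smul_eq_mul]
        ring
      · have h2 : h.syzygy q l = 0 := h.syzygy_apply_of_lt q hl
        simp only [y, Finsupp.sub_apply, Finsupp.smul_apply, h.syzygy_apply_of_lt p hl, h2,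
          smul_zero, sub_zero]
    have hy : y ∈ Submodule.span (MvPolynomial (Fin n) K)
        (h.syzygy '' {r : SyzygyIndex T | (ofLex r.1).1 < (ofLex p.1).1}) := by
      by_cases h0 : y.support.Nonempty
      · have hmem := Finset.max'_mem _ h0
        refine Submodule.span_mono (Set.image_mono ?_)
          (h.mem_span_syzygy (y.support.max' h0) y hyk ?_)
        · intro r hr
          refine lt_of_le_of_lt hr (not_le.1 fun hle => ?_)
          exact Finsupp.mem_support_iff.1 hmem (hy0 _ hle)
        · intro l hl
          by_contra hne
          exact absurd (Finset.le_max' _ l (Finsupp.mem_support_iff.2 hne)) (not_le.2 hl)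
      · rw [Finset.not_nonempty_iff_eq_empty, Finsupp.support_eq_empty] at h0
        rw [h0]; exact zero_mem _
    obtain ⟨c, hc1, hc2, hc3⟩ := exists_homogeneous_coeffs (m := 1) h.syzygy_isHomogeneous hy
      (fun l => ((isHomogeneous_X K t).mul (h.syzygy_isHomogeneous p l)).sub
        ((isHomogeneous_X K _).mul (h.syzygy_isHomogeneous q l)))
    refine ⟨c + Finsupp.single q (X (ofLex p.1).2), fun l => ?_, fun l hl => ?_, ?_⟩
    · refine (hc1 l).add ?_
      rw [Finsupp.single_apply]
      split_ifs
      · exact isHomogeneous_X _ _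
      · exact isHomogeneous_zero _ _ _
    · rw [Finsupp.add_apply, Finsupp.single_apply, if_neg (hqp.trans_le hl).ne, add_zero]
      refine hc2 l fun hlt => absurd hl (not_le.2 ?_)
      rw [← Subtype.coe_lt_coe, Prod.Lex.lt_iff]
      exact Or.inl hlt
    · rw [map_add, ← hc3, Finsupp.linearCombination_single, sub_add_cancel]
  colon p f hf := by
    have h1 : f * X (ofLex p.1).2 ∈ Ideal.span
        (X '' {t | t ∈ T (ofLex p.1).1 ∧ t < (ofLex p.1).2} : Set (MvPolynomial (Fin n) K)) := by
      -- Project to the leading coordinate: syzygies with smaller leading index vanish there, and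
      -- those with the same index contribute their variable.
      have h2 := Submodule.mem_map_of_mem
        (f := Finsupp.lapply (R := MvPolynomial (Fin n) K) (ofLex p.1).1) hf
      rw [Submodule.map_span] at h2
      simp only [Finsupp.lapply_apply, Finsupp.smul_apply, h.syzygy_apply_self, smul_eq_mul] at h2
      refine (Submodule.span_le.2 ?_ : _ ≤ Ideal.span _) h2
      rintro - ⟨-, ⟨q, hq, rfl⟩, rfl⟩
      rw [Set.mem_Iio, ← Subtype.coe_lt_coe, Prod.Lex.lt_iff] at hq
      rw [Finsupp.lapply_apply]
      rcases hq with hq | ⟨hq1, hq2⟩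
      · rw [h.syzygy_apply_of_lt q hq]; exact zero_mem _
      · rw [← hq1, h.syzygy_apply_self q]
        refine Ideal.subset_span ⟨_, ⟨q.2, ?_⟩, rfl⟩
        exact hq2
    exact mem_span_X_of_mul_X_mem (by simp) h1

end LinearSequences
-- Linear resolutions and the upper bound on regularity.
section LinearResolution

open MvPolynomial

variable {n : ℕ} {K : Type*} [Field K]

theorem MvPolynomial.IsHomogeneous.mem_span_range_X {f : MvPolynomial (Fin n) K}
    (hf : f.IsHomogeneous 1) :
    f ∈ Ideal.span (Set.range (X : Fin n → MvPolynomial (Fin n) K)) := by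
  rw [← Set.image_univ, mem_ideal_span_X_image]
  intro m hm
  have h1 : m.degree = 1 := by
    rw [Finsupp.degree_eq_weight_one]; exact hf (mem_support_iff.1 hm)
  by_contra! h
  have h2 : m = 0 := Finsupp.ext fun i => h i trivial
  simp [h2] at h1

theorem linearCombination_single_one {R M ι : Type*} [Semiring R] [AddCommMonoid M] [Module R M]
    (g : ι → M) (b : ι) : Finsupp.linearCombination R g (Finsupp.single b 1) = g b := by
  rw [Finsupp.linearCombination_single, one_smul]

variable (n K) in
/-- A linear sequence of vectors of linear forms, as it occurs in a linear free resolution. -/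
structure LinearStep where
  /-- the basis of the target -/
  κ : Type
  /-- the basis of the source -/
  ι : Type
  linearOrder : LinearOrder ι
  finite_target : Finite κ
  finite_source : Finite ι
  /-- the variables generating the colon ideals -/
  T : ι → Set (Fin n)
  /-- the columns of the matrix -/
  g : ι → κ →₀ MvPolynomial (Fin n) K
  isLinearSequence : IsLinearSequence (K := K) g T
  isHomogeneous : ∀ j l, (g j l).IsHomogeneous 1

theorem finite_syzygyIndex {ι : Type} [LinearOrder ι] [Finite ι] (T : ι → Set (Fin n)) :
    Finite (SyzygyIndex T) :=
  haveI : Finite (ι ×ₗ Fin n) := inferInstanceAs (Finite (ι × Fin n))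
  inferInstance

/-- The linear step formed by the syzygies of a linear sequence. -/
noncomputable def IsLinearSequence.toStep {N : Type*} [AddCommGroup N]
    [Module (MvPolynomial (Fin n) K) N] {ι : Type} [LinearOrder ι] [Finite ι] {g : ι → N}
    {T : ι → Set (Fin n)} (h : IsLinearSequence (K := K) g T) : LinearStep n K where
  κ := ι
  ι := SyzygyIndex T
  linearOrder := inferInstance
  finite_target := inferInstance
  finite_source := finite_syzygyIndex T
  T := _
  g := h.syzygy
  isLinearSequence := h.isLinearSequence_syzygy
  isHomogeneous := h.syzygy_isHomogeneous

/-- The next step of a linear free resolution. -/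
noncomputable def LinearStep.next (s : LinearStep n K) : LinearStep n K :=
  letI := s.linearOrder
  haveI := s.finite_source
  s.isLinearSequence.toStep

theorem LinearStep.ker_eq_range (s : LinearStep n K) :
    LinearMap.ker (Finsupp.linearCombination (MvPolynomial (Fin n) K) s.g) =
      LinearMap.range (Finsupp.linearCombination (MvPolynomial (Fin n) K) s.next.g) :=
  letI := s.linearOrder
  haveI := s.finite_source
  s.isLinearSequence.ker_eq_range_syzygy

/-- The steps of the linear free resolution following a given step. -/
noncomputable def LinearStep.iterate (s : LinearStep n K) : ℕ → LinearStep n K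
  | 0 => s
  | i + 1 => (s.iterate i).next

/-- The linear free resolution of an ideal generated by a linear sequence of forms of degree `d`. -/
noncomputable def IsLinearSequence.resolution {ι : Type} [LinearOrder ι] [Finite ι]
    {g : ι → MvPolynomial (Fin n) K} {T : ι → Set (Fin n)} (h : IsLinearSequence (K := K) g T)
    {d : ℕ} (hg : ∀ j, (g j).IsHomogeneous d) :
    GradedFreeResolution (Ideal.span (Set.range g)) where
  B i := (h.toStep.iterate i).κ
  finite i := (h.toStep.iterate i).finite_target
  deg i _ := d + i
  d i := Finsupp.linearCombination _ (h.toStep.iterate i).g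
  aug := Finsupp.linearCombination _ g
  aug_homogeneous b e he := by
    have h0 := linearCombination_single_one (R := MvPolynomial (Fin n) K) g b
    have he' : e ∈ (g b).support := by rw [← h0]; exact he
    rw [Nat.cast_zero, add_zero, Nat.cast_inj, Finsupp.degree_eq_weight_one]
    exact hg b (mem_support_iff.1 he')
  d_homogeneous i b c e he := by
    have h1 := (h.toStep.iterate i).isHomogeneous b c
    have h2 := linearCombination_single_one (R := MvPolynomial (Fin n) K) (h.toStep.iterate i).g b
    have h3 : e.degree = 1 := by
      rw [Finsupp.degree_eq_weight_one]
      refine h1 (mem_support_iff.1 ?_)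
      rw [← h2]
      exact he
    rw [h3]; push_cast; ring
  range_aug := Finsupp.range_linearCombination _
  exact_zero := h.ker_eq_range_syzygy
  exact_succ i := (h.toStep.iterate i).ker_eq_range

theorem IsLinearSequence.regularity_le {ι : Type} [LinearOrder ι] [Finite ι]
    {g : ι → MvPolynomial (Fin n) K} {T : ι → Set (Fin n)} (h : IsLinearSequence (K := K) g T)
    {d : ℕ} (hg : ∀ j, (g j).IsHomogeneous d) :
    regularity (Ideal.span (Set.range g)) ≤ ((d : ℝ) : EReal) := by
  have hmin : (h.resolution hg).IsMinimal := by
    have hd : ∀ i (b : (h.toStep.iterate i).ι) c, Finsupp.linearCombination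
        (MvPolynomial (Fin n) K) (h.toStep.iterate i).g (Finsupp.single b 1) c ∈
        Ideal.span (Set.range (X : Fin n → MvPolynomial (Fin n) K)) := by
      intro i b c
      rw [linearCombination_single_one]
      exact ((h.toStep.iterate i).isHomogeneous b c).mem_span_range_X
    exact hd
  refine (iInf₂_le _ hmin).trans (iSup₂_le fun i b => ?_)
  have h3 : (h.resolution hg).deg i b - (i : ℤ) = d := add_sub_cancel_right _ _
  rw [h3, Int.cast_natCast]

/-- If `v` precedes `a` lexicographically and `s` is the first coordinate where they differ,
exchange at `s` moves a unit to some `p` with `a p < v p`. Then `p` comes after `s`, so the new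
basis also precedes `a`, and `X p` divides every monomial multiplying `a` into a multiple of `v`. -/
theorem HasExchange.isLinearSequence {B : Set (Fin n →₀ ℕ)} (hB : HasExchange B) :
    IsLinearSequence (K := K)
      (fun a : {a : Lex (Fin n →₀ ℕ) // ofLex a ∈ B} => monomial (ofLex a.1) (1 : K))
      (fun a => {p | ∃ s, ∃ w ∈ B, toLex w < a.1 ∧
        w + Finsupp.single s 1 = ofLex a.1 + Finsupp.single p 1}) where
  rel := by
    rintro ⟨a, ha⟩ t ⟨s, w, hw, hwa, h⟩
    refine ⟨Finsupp.single ⟨toLex w, hw⟩ (X s), fun l => ?_, fun l hl => ?_, ?_⟩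
    · rw [Finsupp.single_apply]
      split_ifs
      · exact isHomogeneous_X _ _
      · exact isHomogeneous_zero _ _ _
    · rw [Finsupp.single_apply, if_neg]
      rintro rfl
      exact absurd hwa (not_lt.2 hl)
    · rw [Finsupp.linearCombination_single, smul_eq_mul, smul_eq_mul, X, X, monomial_mul,
        monomial_mul, add_comm, ← h, add_comm]
      rfl
  colon := by
    rintro ⟨a, ha⟩ f hf
    have h1 : f * monomial (ofLex a) 1 ∈ Ideal.span
        ((fun v => monomial v (1 : K)) '' {v | v ∈ B ∧ toLex v < a}) := by
      refine (Submodule.span_mono ?_ : Submodule.span _ _ ≤ _) hf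
      rintro - ⟨v, hv, rfl⟩
      exact ⟨ofLex v.1, ⟨v.2, hv⟩, rfl⟩
    rw [mem_ideal_span_monomial_image] at h1
    rw [mem_ideal_span_X_image]
    intro m hm
    obtain ⟨v, ⟨hv, hva⟩, hvm⟩ := h1 (m + ofLex a) (by
      rw [mem_support_iff, coeff_mul_monomial, mul_one]
      exact mem_support_iff.1 hm)
    obtain ⟨s, hs1, hs2⟩ := Finsupp.Lex.lt_iff.1 hva
    obtain ⟨p, hp, w, hw, hwp⟩ := hB _ ha v hv s hs2
    refine ⟨p, ⟨s, w, hw, ?_, hwp⟩, ?_⟩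
    · have hl : ∀ l, w l + (if s = l then 1 else 0) = ofLex a l + (if p = l then 1 else 0) := by
        intro l
        simpa [Finsupp.single_apply] using DFunLike.congr_fun hwp l
      have hps : ∀ j ≤ s, p ≠ j := by
        rintro j hj rfl
        rcases hj.eq_or_lt with rfl | hj
        · exact absurd hp hs2.not_gt
        · exact hp.ne' (hs1 p hj)
      refine Finsupp.Lex.lt_iff.2 ⟨s, fun j hj => ?_, ?_⟩
      · have := hl j
        rwa [if_neg hj.ne', if_neg (hps j hj.le)] at this
      · have := hl s
        rw [if_pos rfl, if_neg (hps s le_rfl)] at this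
        change w s < ofLex a s
        omega
    · have := hvm p
      rw [Finsupp.add_apply] at this
      omega

theorem HasExchange.regularity_span_le {B : Set (Fin n →₀ ℕ)} (hB : HasExchange B) (hfin : B.Finite)
    {d : ℕ} (hd : ∀ u ∈ B, u.degree = d) :
    regularity (Ideal.span ((fun a => monomial a (1 : K)) '' B)) ≤ ((d : ℝ) : EReal) := by
  have : Finite {a : Lex (Fin n →₀ ℕ) // ofLex a ∈ B} := hfin
  have h := (hB.isLinearSequence (K := K)).regularity_le (d := d)
    (fun j => isHomogeneous_monomial _ (hd _ j.2))
  convert h using 3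
  ext f
  constructor
  · rintro ⟨a, ha, rfl⟩
    exact ⟨⟨toLex a, ha⟩, rfl⟩
  · rintro ⟨a, rfl⟩
    exact ⟨ofLex a.1, a.2, rfl⟩

end LinearResolution
-- Monomial primes, weights on their variables, and the lower bound.
section MonomialPrimes

open MvPolynomial

variable {n : ℕ} {K : Type*} [Field K]

/-- The homomorphism `S → S[t]` multiplying each variable indexed by `T` by `t`. -/
noncomputable def gradingHom (K : Type*) [Field K] (T : Finset (Fin n)) :
    MvPolynomial (Fin n) K →+* Polynomial (MvPolynomial (Fin n) K) :=
  eval₂Hom (Polynomial.C.comp C)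
    (fun l => (if l ∈ T then Polynomial.X else 1) * Polynomial.C (X l))

theorem gradingHom_monomial (T : Finset (Fin n)) (e : Fin n →₀ ℕ) (c : K) :
    gradingHom K T (monomial e c) = Polynomial.monomial (∑ l ∈ T, e l) (monomial e c) := by
  have h1 : ∏ l, (if l ∈ T then (Polynomial.X : Polynomial (MvPolynomial (Fin n) K)) else 1) ^ e l
      = Polynomial.X ^ ∑ l ∈ T, e l := by
    rw [← Finset.prod_pow_eq_pow_sum]
    simp only [ite_pow, one_pow, Finset.prod_ite_mem, Finset.univ_inter]
  rw [gradingHom, coe_eval₂Hom, eval₂_monomial, Finsupp.prod_fintype _ _ (by simp)]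
  simp only [mul_pow]
  rw [Finset.prod_mul_distrib, h1, monomial_eq, Finsupp.prod_fintype _ _ (by simp),
    ← Polynomial.C_mul_X_pow_eq_monomial]
  simp only [map_mul, map_prod, map_pow, RingHom.comp_apply]
  ring

theorem coeff_coeff_gradingHom (T : Finset (Fin n)) (f : MvPolynomial (Fin n) K) (j : ℕ)
    (e : Fin n →₀ ℕ) :
    coeff e ((gradingHom K T f).coeff j) = if ∑ l ∈ T, e l = j then coeff e f else 0 := by
  induction f using MvPolynomial.induction_on' with
  | monomial d c =>
    rw [gradingHom_monomial, Polynomial.coeff_monomial, coeff_monomial]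
    by_cases hde : d = e
    · subst hde
      rw [if_pos rfl]
      split_ifs
      · rw [coeff_monomial, if_pos rfl]
      · rw [coeff_zero]
    · split_ifs <;> simp [coeff_monomial, hde]
  | add p q hp hq =>
    rw [map_add, Polynomial.coeff_add, coeff_add, hp, hq, coeff_add]
    split_ifs <;> simp

theorem X_pow_dvd_gradingHom_iff {T : Finset (Fin n)} {f : MvPolynomial (Fin n) K} {m : ℕ} :
    Polynomial.X ^ m ∣ gradingHom K T f ↔ ∀ e ∈ f.support, m ≤ ∑ l ∈ T, e l := by
  rw [Polynomial.X_pow_dvd_iff]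
  constructor
  · intro h e he
    by_contra! hlt
    have := coeff_coeff_gradingHom T f (∑ l ∈ T, e l) e
    rw [h _ hlt, if_pos rfl, coeff_zero] at this
    exact mem_support_iff.1 he this.symm
  · intro h j hj
    ext e
    rw [coeff_coeff_gradingHom, coeff_zero, ite_eq_right_iff]
    rintro rfl
    by_contra hne
    exact absurd (h e (mem_support_iff.2 hne)) (not_le.2 hj)

/-- Turns membership in a monomial prime, and weight bounds, into divisibility by powers of the
prime element `Polynomial.X`. -/
theorem mem_span_X_iff_X_dvd {T : Finset (Fin n)} {f : MvPolynomial (Fin n) K} :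
    f ∈ Ideal.span (X '' (T : Set (Fin n)) : Set (MvPolynomial (Fin n) K)) ↔
      Polynomial.X ∣ gradingHom K T f := by
  rw [← pow_one Polynomial.X, X_pow_dvd_gradingHom_iff, mem_ideal_span_X_image]
  refine forall₂_congr fun e _ => ?_
  rw [Nat.one_le_iff_ne_zero, Ne, Finset.sum_eq_zero_iff]
  push Not
  rfl

theorem isPrime_span_X (T : Finset (Fin n)) :
    (Ideal.span (X '' (T : Set (Fin n)) : Set (MvPolynomial (Fin n) K))).IsPrime := by
  have h : Ideal.span (X '' (T : Set (Fin n)) : Set (MvPolynomial (Fin n) K)) =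
      (Ideal.span {Polynomial.X}).comap (gradingHom K T) := by
    ext f
    rw [Ideal.mem_comap, Ideal.mem_span_singleton, mem_span_X_iff_X_dvd]
  have := (Ideal.span_singleton_prime Polynomial.X_ne_zero).2
    (Polynomial.prime_X (R := MvPolynomial (Fin n) K))
  rw [h]
  exact Ideal.comap_isPrime _ _

theorem span_monomial_le_span_X {B : Set (Fin n →₀ ℕ)} {T : Set (Fin n)}
    (h : ∀ u ∈ B, ∃ l ∈ T, u l ≠ 0) :
    Ideal.span ((fun a => monomial a (1 : K)) '' B) ≤ Ideal.span (X '' T) := by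
  rw [Ideal.span_le]
  rintro - ⟨u, hu, rfl⟩
  rw [SetLike.mem_coe, mem_ideal_span_X_image]
  intro m hm
  rw [Finset.mem_singleton.1 (support_monomial_subset hm)]; exact h u hu

/-- A minimal prime of a monomial ideal is generated by a minimal set of variables meeting the
supports of all generators. -/
theorem exists_eq_span_X_of_mem_minimalPrimes {B : Set (Fin n →₀ ℕ)}
    {P : Ideal (MvPolynomial (Fin n) K)}
    (hP : P ∈ (Ideal.span ((fun a => monomial a (1 : K)) '' B)).minimalPrimes) :
    ∃ T : Finset (Fin n), P = Ideal.span (X '' (T : Set (Fin n))) ∧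
      ∀ l ∈ T, ∃ v ∈ B, ∀ l' ∈ T, l' ≠ l → v l' = 0 := by
  classical
  have hprime : P.IsPrime := hP.1.1
  let T : Finset (Fin n) := Finset.univ.filter fun l => (X l : MvPolynomial (Fin n) K) ∈ P
  have hTP : Ideal.span (X '' (T : Set (Fin n))) ≤ P := by
    rw [Ideal.span_le]
    rintro - ⟨l, hl, rfl⟩
    exact (Finset.mem_filter.1 hl).2
  have hB : ∀ u ∈ B, ∃ l ∈ T, u l ≠ 0 := by
    intro u hu
    have h1 : monomial u (1 : K) ∈ P := hP.1.2 (Ideal.subset_span ⟨u, hu, rfl⟩)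
    rw [monomial_eq, map_one, one_mul, Finsupp.prod, hprime.prod_mem_iff] at h1
    obtain ⟨l, hl, hlP⟩ := h1
    exact ⟨l, Finset.mem_filter.2 ⟨Finset.mem_univ _, hprime.mem_of_pow_mem _ hlP⟩,
      Finsupp.mem_support_iff.1 hl⟩
  have hPT : P = Ideal.span (X '' (T : Set (Fin n))) :=
    le_antisymm (hP.2 ⟨isPrime_span_X T, span_monomial_le_span_X hB⟩ hTP) hTP
  refine ⟨T, hPT, fun l hl => ?_⟩
  by_contra! h
  have hle : P ≤ Ideal.span (X '' ((T.erase l : Finset (Fin n)) : Set (Fin n))) := by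
    refine hP.2 ⟨isPrime_span_X _, span_monomial_le_span_X fun u hu => ?_⟩ ?_
    · obtain ⟨l', hl', hne, hul⟩ := h u hu
      exact ⟨l', Finset.mem_coe.2 (Finset.mem_erase.2 ⟨hne, hl'⟩), hul⟩
    · rw [hPT]
      exact Ideal.span_mono (Set.image_mono (Finset.coe_subset.2 (Finset.erase_subset _ _)))
  have hX := hle ((Finset.mem_filter.1 hl).2)
  rw [mem_ideal_span_X_image] at hX
  obtain ⟨i, hi, hne⟩ := hX (Finsupp.single l 1) (by simp [support_X])
  refine hne (Finsupp.single_eq_of_ne ?_)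
  exact (Finset.mem_erase.1 (Finset.mem_coe.1 hi)).1

/-- If each variable of `T` alone supports some member of `B` on `T`, then every vector of large
enough weight on `T` dominates a member of `B` on `T`. -/
theorem HasExchange.exists_le_on {B : Set (Fin n →₀ ℕ)} (hB : HasExchange B) {T : Finset (Fin n)}
    (hT : ∀ l ∈ T, ∃ v ∈ B, ∀ l' ∈ T, l' ≠ l → v l' = 0) {w₀ : Fin n →₀ ℕ} (hw₀ : w₀ ∈ B)
    (hmin : ∀ w ∈ B, ∑ l ∈ T, w₀ l ≤ ∑ l ∈ T, w l) {a : Fin n →₀ ℕ}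
    (ha : ∑ l ∈ T, w₀ l ≤ ∑ l ∈ T, a l) : ∃ w ∈ B, ∀ l ∈ T, w l ≤ a l := by
  suffices H : ∀ N, ∀ w ∈ B, ∑ l ∈ T, w l = ∑ l ∈ T, w₀ l → ∑ l ∈ T, (w l - a l) = N →
      ∃ w ∈ B, ∀ l ∈ T, w l ≤ a l from H _ w₀ hw₀ rfl rfl
  intro N
  induction N using Nat.strong_induction_on with
  | _ N ih =>
  intro w hw hwm hN
  by_contra! hcon
  obtain ⟨l, hl, hal⟩ := hcon w hw
  obtain ⟨m, hm, hwa⟩ : ∃ m ∈ T, w m < a m := by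
    by_contra! h
    exact absurd (Finset.sum_lt_sum h ⟨l, hl, hal⟩) (by omega)
  have hlm : l ≠ m := by rintro rfl; omega
  obtain ⟨v, hv, hvT⟩ := hT m hm
  -- Since `v` vanishes on `T` away from `m`, the unit taken from `l` goes to `m` or leaves `T`.
  -- Leaving `T` would push the weight below the minimum.
  obtain ⟨p, hp, w', hw', hwp⟩ := hB w hw v hv l (by rw [hvT l hl hlm]; omega)
  have hval : ∀ i, w' i + (if l = i then 1 else 0) = w i + (if p = i then 1 else 0) := by
    intro i
    simpa [Finsupp.single_apply] using DFunLike.congr_fun hwp i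
  have hsum := Finset.sum_congr (rfl : T = T) fun i _ => hval i
  rw [Finset.sum_add_distrib, Finset.sum_add_distrib, Finset.sum_ite_eq, Finset.sum_ite_eq,
    if_pos hl] at hsum
  have hw'm := hmin w' hw'
  by_cases hpT : p ∈ T
  · rw [if_pos hpT] at hsum
    have hpm : p = m := by
      by_contra hne
      rw [hvT p hpT hne] at hp
      omega
    subst hpm
    have hlt : ∑ i ∈ T, (w' i - a i) < ∑ i ∈ T, (w i - a i) := by
      refine Finset.sum_lt_sum (fun i _ => ?_) ⟨l, hl, ?_⟩
      · have := hval i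
        by_cases hpi : p = i
        · subst hpi; rw [if_neg hlm, if_pos rfl] at this; omega
        · rw [if_neg hpi] at this; split_ifs at this <;> omega
      · have := hval l
        rw [if_pos rfl, if_neg hlm.symm] at this
        omega
    exact absurd (ih _ (by omega) w' hw' (by omega) rfl) (by simpa using hcon)
  · rw [if_neg hpT] at hsum
    omega

/-- Divide the monomial of `u` by the variable of `i` to get an exponent `c` outside the ideal, and
take an associated prime containing its annihilator. If `u` were not of least weight on `T`, then
`c` would still dominate on `T` some `w ∈ B`, and the monomial of `w - c`, which involves no
variable of `T`, would lie in that prime. -/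
theorem HasExchange.exists_associatedPrime {B : Set (Fin n →₀ ℕ)} (hB : HasExchange B) {d : ℕ}
    (hd : ∀ u ∈ B, u.degree = d)
    (hI : HasNoEmbeddedPrimes (Ideal.span ((fun a => monomial a (1 : K)) '' B)))
    {u : Fin n →₀ ℕ} (hu : u ∈ B) {i : Fin n} (hi : u i ≠ 0) :
    ∃ T : Finset (Fin n), i ∈ T ∧ (∀ w ∈ B, ∑ l ∈ T, u l ≤ ∑ l ∈ T, w l) ∧
      Ideal.span (X '' (T : Set (Fin n))) ∈ associatedPrimes (MvPolynomial (Fin n) K)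
        (MvPolynomial (Fin n) K ⧸ Ideal.span ((fun a => monomial a (1 : K)) '' B)) := by
  obtain ⟨c, hcu⟩ : ∃ c, u = c + Finsupp.single i 1 := by
    have hle : Finsupp.single i 1 ≤ u := by rw [Finsupp.single_le_iff]; omega
    obtain ⟨c, rfl⟩ := exists_add_of_le hle
    exact ⟨c, add_comm _ _⟩
  set I := Ideal.span ((fun a => monomial a (1 : K)) '' B) with hIdef
  -- The degree of `c` is `d - 1`, too small to be a multiple of a generator.
  have hc : monomial c (1 : K) ∉ I := by
    intro h
    rw [hIdef, mem_ideal_span_monomial_image] at h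
    obtain ⟨w, hw, hwc⟩ := h c (by simp)
    have h1 := Finsupp.degree_mono hwc
    have h2 := hd _ hu
    rw [hcu, map_add, Finsupp.degree_single] at h2
    have := hd w hw
    omega
  obtain ⟨P, hP, hcP⟩ := exists_le_isAssociatedPrime_of_isNoetherianRing
    (MvPolynomial (Fin n) K) (Ideal.Quotient.mk I (monomial c 1))
    (by rwa [Ne, Ideal.Quotient.eq_zero_iff_mem])
  have hcol : ∀ s, s * monomial c 1 ∈ I → s ∈ P := by
    intro s hs
    apply hcP
    rw [Submodule.mem_colon_singleton, Submodule.mem_bot]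
    exact Ideal.Quotient.eq_zero_iff_mem.2 hs
  obtain ⟨T, rfl, hT⟩ := exists_eq_span_X_of_mem_minimalPrimes (hI P hP)
  have hiT : i ∈ T := by
    have h1 := hcol (X i) (by
      rw [X, monomial_mul, one_mul, add_comm, ← hcu]
      exact Ideal.subset_span ⟨_, hu, rfl⟩)
    rw [mem_ideal_span_X_image] at h1
    obtain ⟨j, hj, hne⟩ := h1 (Finsupp.single i 1) (by simp [support_X])
    by_cases hij : i = j
    · subst hij; exact hj
    · rw [Finsupp.single_apply, if_neg hij] at hne; exact absurd rfl hne
  refine ⟨T, hiT, ?_, hP⟩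
  obtain ⟨w₀, hw₀, hmin⟩ := (measure fun w : Fin n →₀ ℕ => ∑ l ∈ T, w l).wf.has_min B ⟨_, hu⟩
  have hmin' : ∀ w ∈ B, ∑ l ∈ T, w₀ l ≤ ∑ l ∈ T, w l := fun w hw => not_lt.1 (hmin w hw)
  suffices h : ∑ l ∈ T, u l ≤ ∑ l ∈ T, w₀ l from
    fun w hw => h.trans (hmin' w hw)
  by_contra! hlt
  have hsum : ∑ l ∈ T, u l = ∑ l ∈ T, c l + 1 := by
    simp only [hcu, Finsupp.add_apply, Finset.sum_add_distrib, Finsupp.single_apply]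
    rw [Finset.sum_ite_eq, if_pos hiT]
  obtain ⟨w, hw, hwc⟩ := hB.exists_le_on hT hw₀ hmin' (a := c) (by omega)
  have h1 := hcol (monomial (w - c) 1) (by
    rw [monomial_mul, one_mul, hIdef, mem_ideal_span_monomial_image]
    intro e he
    rw [Finset.mem_singleton.1 (support_monomial_subset he)]
    exact ⟨w, hw, le_tsub_add⟩)
  rw [mem_ideal_span_X_image] at h1
  obtain ⟨l, hl, hne⟩ := h1 (w - c) (by simp)
  exact hne (Nat.sub_eq_zero_of_le (hwc l hl))

theorem le_symbolicPower {R : Type*} [CommRing R] (I : Ideal R) (k : ℕ) :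
    I ^ k ≤ symbolicPower I k :=
  le_iInf fun _ => Ideal.le_comap_map

/-- Some `s` outside the prime satisfies `s * f ∈ I ^ k`, whose elements have weight at least `m *
k` on `T`. Primality of `Polynomial.X` transfers the whole power to the image of `f`. -/
theorem le_sum_of_mem_symbolicPower {B : Set (Fin n →₀ ℕ)} {T : Finset (Fin n)}
    (hT : Ideal.span (X '' (T : Set (Fin n))) ∈ associatedPrimes (MvPolynomial (Fin n) K)
        (MvPolynomial (Fin n) K ⧸ Ideal.span ((fun a => monomial a (1 : K)) '' B)))
    {m : ℕ} (hm : ∀ w ∈ B, m ≤ ∑ l ∈ T, w l) {k : ℕ} {f : MvPolynomial (Fin n) K}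
    (hf : f ∈ symbolicPower (Ideal.span ((fun a => monomial a (1 : K)) '' B)) k)
    {e : Fin n →₀ ℕ} (he : e ∈ f.support) : m * k ≤ ∑ l ∈ T, e l := by
  have hP := isPrime_span_X (K := K) T
  have h1 := (Submodule.mem_iInf _).1 hf ⟨_, hT⟩
  rw [Ideal.mem_comap, IsLocalization.algebraMap_mem_map_algebraMap_iff
    (Ideal.span (X '' (T : Set (Fin n)) : Set (MvPolynomial (Fin n) K))).primeCompl] at h1
  obtain ⟨s, hs, hsf⟩ := h1
  have hle : Ideal.span ((fun a => monomial a (1 : K)) '' B) ^ k ≤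
      (Ideal.span {Polynomial.X ^ (m * k)}).comap (gradingHom K T) := by
    rw [pow_mul, ← Ideal.span_singleton_pow]
    refine le_trans (Ideal.pow_right_mono ?_ k) (Ideal.le_comap_pow _ k)
    rw [Ideal.span_le]
    rintro - ⟨w, hw, rfl⟩
    rw [SetLike.mem_coe, Ideal.mem_comap, Ideal.mem_span_singleton, X_pow_dvd_gradingHom_iff]
    intro e he
    rw [Finset.mem_singleton.1 (support_monomial_subset he)]; exact hm w hw
  have h2 := hle hsf
  rw [Ideal.mem_comap, Ideal.mem_span_singleton, map_mul] at h2
  exact X_pow_dvd_gradingHom_iff.1 (Polynomial.prime_X.pow_dvd_of_dvd_mul_left _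
    (fun h => hs (mem_span_X_iff_X_dvd.2 h)) h2) e he

/-- A minimal monomial of an ideal occurs as a degree in each of its graded free resolutions. -/
theorem GradedFreeResolution.exists_deg_eq {J : Ideal (MvPolynomial (Fin n) K)}
    (F : GradedFreeResolution J) {a : Fin n →₀ ℕ} (ha : monomial a (1 : K) ∈ J)
    (hmin : ∀ f ∈ J, ∀ e ∈ f.support, e ≤ a → e = a) : ∃ b, F.deg 0 b = a.degree := by
  classical
  rw [← F.range_aug] at ha
  obtain ⟨x, hx⟩ := ha
  have hx' : F.aug x = ∑ b ∈ x.support, x b * F.aug (Finsupp.single b 1) := by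
    conv_lhs => rw [← x.sum_single, Finsupp.sum, map_sum]
    refine Finset.sum_congr rfl fun b _ => ?_
    rw [← smul_eq_mul, ← map_smul, Finsupp.smul_single, smul_eq_mul, mul_one]
  have h1 : coeff a (F.aug x) ≠ 0 := by rw [hx]; simp
  rw [hx', coeff_sum] at h1
  obtain ⟨b, -, hb⟩ := Finset.exists_ne_zero_of_sum_ne_zero h1
  rw [coeff_mul] at hb
  obtain ⟨⟨e, e'⟩, hee, hne⟩ := Finset.exists_ne_zero_of_sum_ne_zero hb
  have he' : e' ∈ (F.aug (Finsupp.single b 1)).support :=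
    mem_support_iff.2 (right_ne_zero_of_mul hne)
  have hle : e' ≤ a := by
    rw [← Finset.HasAntidiagonal.mem_antidiagonal.1 hee]; exact le_add_self
  have hJ : F.aug (Finsupp.single b 1) ∈ J :=
    F.range_aug.le (LinearMap.mem_range_self _ _)
  refine ⟨b, ?_⟩
  rw [← F.aug_homogeneous b e' he', hmin _ hJ e' he' hle]

theorem HasExchange.le_regularity_symbolicPower {B : Set (Fin n →₀ ℕ)} (hB : HasExchange B) {d : ℕ}
    (hd : ∀ u ∈ B, u.degree = d) (hne : B.Nonempty)
    (hI : HasNoEmbeddedPrimes (Ideal.span ((fun a => monomial a (1 : K)) '' B))) (k : ℕ) :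
    (((k * d : ℕ) : ℝ) : EReal) ≤
      regularity (symbolicPower (Ideal.span ((fun a => monomial a (1 : K)) '' B)) k) := by
  obtain ⟨u, hu⟩ := hne
  refine le_iInf₂ fun F _ => ?_
  have hmem : monomial (k • u) (1 : K) ∈
      symbolicPower (Ideal.span ((fun a => monomial a (1 : K)) '' B)) k := by
    apply le_symbolicPower
    have h1 : monomial (k • u) (1 : K) = monomial u 1 ^ k := by rw [monomial_pow, one_pow]
    rw [h1]
    exact Ideal.pow_mem_pow (Ideal.subset_span (Set.mem_image_of_mem _ hu)) k
  -- Quantifying over all supports avoids having to show that the symbolic power is a monomial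
  -- ideal.
  have hminimal : ∀ f ∈ symbolicPower (Ideal.span ((fun a => monomial a (1 : K)) '' B)) k,
      ∀ e ∈ f.support, e ≤ k • u → e = k • u := by
    intro f hf e he hle
    by_contra hcon
    obtain ⟨i, hi⟩ : ∃ i, e i < (k • u) i := by
      by_contra! h
      exact hcon (le_antisymm hle h)
    have hui : u i ≠ 0 := by
      intro h0
      rw [Finsupp.smul_apply, h0, smul_zero] at hi
      omega
    obtain ⟨T, hiT, hmin, hT⟩ := hB.exists_associatedPrime hd hI hu hui
    have h1 := le_sum_of_mem_symbolicPower hT hmin hf he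
    have h2 : ∑ l ∈ T, e l < ∑ l ∈ T, (k • u) l :=
      Finset.sum_lt_sum (fun l _ => hle l) ⟨i, hiT, hi⟩
    simp only [Finsupp.smul_apply, smul_eq_mul, ← Finset.mul_sum] at h2
    rw [mul_comm] at h1
    omega
  obtain ⟨b, hb⟩ := F.exists_deg_eq hmem hminimal
  refine le_iSup₂_of_le 0 b (le_of_eq ?_)
  rw [hb, map_nsmul, hd u hu, Nat.cast_zero, sub_zero, smul_eq_mul, Int.cast_natCast]

open Pointwise in
theorem finite_nsmul {B : Set (Fin n →₀ ℕ)} (hB : B.Finite) (k : ℕ) : (k • B).Finite := by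
  induction k with
  | zero => rw [zero_nsmul]; exact Set.finite_zero
  | succ k ih => rw [succ_nsmul]; exact ih.add hB

theorem HasExchange.regularity_pow_le_symbolicPower {B : Set (Fin n →₀ ℕ)} (hB : HasExchange B)
    (hfin : B.Finite) (hne : B.Nonempty) {d : ℕ} (hd : ∀ u ∈ B, u.degree = d)
    (hI : HasNoEmbeddedPrimes (Ideal.span ((fun a => monomial a (1 : K)) '' B))) (k : ℕ) :
    regularity (Ideal.span ((fun a => monomial a (1 : K)) '' B) ^ k) ≤
      regularity (symbolicPower (Ideal.span ((fun a => monomial a (1 : K)) '' B)) k) := by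
  refine le_trans ?_ (hB.le_regularity_symbolicPower hd hne hI k)
  rw [span_monomial_pow]
  exact (hB.nsmul k).regularity_span_le (finite_nsmul hfin k)
    fun u hu => degree_eq_of_mem_nsmul hd k hu

end MonomialPrimes

/-! ### Radical ideals and squarefree monomial ideals. -/

section Radical

open MvPolynomial

/-- Write `P` as the colon of `I` by `f`. It contains the intersection of the minimal primes
avoiding `f`, hence one of them, `Q`; and `P ≤ Q` because `P` multiplies `f` into `Q`. -/
theorem HasNoEmbeddedPrimes.of_isRadical {R : Type*} [CommRing R] [IsNoetherianRing R] {I : Ideal R}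
    (hI : I.IsRadical) : HasNoEmbeddedPrimes I := by
  classical
  intro P hP
  obtain ⟨hprime, x, hx⟩ := isAssociatedPrime_iff.1 hP
  obtain ⟨f, rfl⟩ := Ideal.Quotient.mk_surjective x
  have hmem : ∀ r, r ∈ P ↔ r * f ∈ I := by
    intro r
    rw [hx, Submodule.mem_colon_singleton, Submodule.mem_bot]
    exact Ideal.Quotient.eq_zero_iff_mem (a := r * f)
  have hfin : {Q ∈ I.minimalPrimes | f ∉ Q}.Finite :=
    (Ideal.finite_minimalPrimes_of_isNoetherianRing R I).subset (Set.sep_subset _ _)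
  have hinf : hfin.toFinset.inf id ≤ P := by
    intro r hr
    rw [hmem, ← hI.radical, ← Ideal.sInf_minimalPrimes, Submodule.mem_sInf]
    intro Q hQ
    by_cases hfQ : f ∈ Q
    · exact Ideal.mul_mem_left Q _ hfQ
    · exact Ideal.mul_mem_right _ Q ((Submodule.mem_finsetInf.1 hr) Q (hfin.mem_toFinset.2 ⟨hQ, hfQ⟩))
  obtain ⟨Q, hQ, hQP⟩ := (Ideal.IsPrime.inf_le' hprime).1 hinf
  obtain ⟨hQm, hfQ⟩ := hfin.mem_toFinset.1 hQ
  have hPQ : P ≤ Q := fun r hr =>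
    (hQm.1.1.mem_or_mem (hQm.1.2 ((hmem r).1 hr))).resolve_right hfQ
  rwa [le_antisymm hPQ hQP]

/-- The leading exponent of a power of `f` is a multiple of the leading exponent `e` of `f`, and a
squarefree exponent below a multiple of `e` is already below `e`. So the leading term lies in the
ideal and can be subtracted. -/
theorem isRadical_span_squarefree {n : ℕ} {K : Type*} [Field K] {B : Set (Fin n →₀ ℕ)}
    (hB : ∀ a ∈ B, ∀ i, a i ≤ 1) : (Ideal.span ((fun a => monomial a (1 : K)) '' B)).IsRadical := by
  set I := Ideal.span ((fun a => monomial a (1 : K)) '' B) with hI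
  suffices H : ∀ N, ∀ f ∈ I.radical, f.support.card = N → f ∈ I from fun f hf => H _ f hf rfl
  intro N
  induction N using Nat.strong_induction_on with
  | _ N ih =>
  intro f hf hN
  by_cases h0 : f = 0
  · rw [h0]; exact zero_mem _
  set e := MonomialOrder.lex.degree f with he
  have hes : e ∈ f.support := MonomialOrder.degree_mem_support h0
  have heI : ∀ c : K, monomial e c ∈ I := by
    obtain ⟨k, hk⟩ := hf
    rw [hI, mem_ideal_span_monomial_image] at hk
    obtain ⟨b, hb, hbe⟩ := hk (k • e) (by
      rw [he, ← MonomialOrder.degree_pow]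
      exact MonomialOrder.degree_mem_support (pow_ne_zero _ h0))
    intro c
    rw [hI, mem_ideal_span_monomial_image]
    intro e' he'
    rw [Finset.mem_singleton.1 (support_monomial_subset he')]
    refine ⟨b, hb, fun i => ?_⟩
    have h1 := hbe i
    have h2 := hB b hb i
    rw [Finsupp.smul_apply, smul_eq_mul] at h1
    rcases Nat.eq_zero_or_pos (e i) with h3 | h3
    · rw [h3, mul_zero] at h1; omega
    · omega
  have hsub : (f - monomial e (coeff e f)).support ⊆ f.support.erase e := by
    intro m hm
    rw [mem_support_iff, coeff_sub, coeff_monomial] at hm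
    rw [Finset.mem_erase, mem_support_iff]
    by_cases hme : e = m
    · subst hme; simp at hm
    · rw [if_neg hme, sub_zero] at hm
      exact ⟨fun h => hme h.symm, hm⟩
  have hcard := Finset.card_le_card hsub
  rw [Finset.card_erase_of_mem hes] at hcard
  have hpos := Finset.card_pos.2 ⟨e, hes⟩
  have h1 := ih _ (by omega) (f - monomial e (coeff e f))
    (sub_mem hf (Ideal.le_radical (heI _))) rfl
  simpa using add_mem h1 (heI (coeff e f))

end Radical

/-! ### Minimal generators, the zero ideal, and the conclusion. -/

theorem IsMonomialIdeal.eq_span_minimalExponents {n : ℕ} {K : Type*} [Field K]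
    {I : Ideal (MvPolynomial (Fin n) K)} (hI : IsMonomialIdeal I) :
    I = Ideal.span ((fun a => MvPolynomial.monomial a (1 : K)) '' minimalExponents I) := by
  apply le_antisymm
  · obtain ⟨A, hA⟩ := hI
    conv_lhs => rw [hA]
    rw [Ideal.span_le]
    rintro - ⟨a, ha, rfl⟩
    obtain ⟨b, hba, hb⟩ := exists_minimal_le_of_wellFoundedLT
      (fun b => MvPolynomial.monomial b (1 : K) ∈ I) a (by rw [hA]; exact Ideal.subset_span ⟨a, ha, rfl⟩)
    rw [SetLike.mem_coe, MvPolynomial.mem_ideal_span_monomial_image]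
    intro e he
    rw [Finset.mem_singleton.1 (MvPolynomial.support_monomial_subset he)]
    exact ⟨b, hb, hba⟩
  · rw [Ideal.span_le]
    rintro - ⟨a, ha, rfl⟩
    exact Minimal.prop (P := fun b => MvPolynomial.monomial b (1 : K) ∈ I) ha

theorem symbolicPower_bot {R : Type*} [CommRing R] [IsDomain R] [IsNoetherianRing R] {k : ℕ}
    (hk : 1 ≤ k) : symbolicPower (⊥ : Ideal R) k = ⊥ := by
  rw [eq_bot_iff]
  have : Nontrivial (R ⧸ (⊥ : Ideal R)) := Ideal.Quotient.nontrivial_iff.2 bot_ne_top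
  obtain ⟨P, hP⟩ := associatedPrimes.nonempty R (R ⧸ (⊥ : Ideal R))
  have := hP.isPrime
  refine (iInf_le _ ⟨P, hP⟩).trans ?_
  rw [Ideal.bot_pow (by omega), Ideal.map_bot, ← RingHom.ker_eq_comap_bot,
    (RingHom.injective_iff_ker_eq_bot _).1
      (IsLocalization.injective (Localization.AtPrime P) P.primeCompl_le_nonZeroDivisors)]

theorem corollary1p3 {n : ℕ} {K : Type*} [Field K] (I : Ideal (MvPolynomial (Fin n) K))
    (hI : IsPolymatroidal I) :
    (IsMatroidal I → HasNoEmbeddedPrimes I) ∧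
    (HasNoEmbeddedPrimes I →
      ∀ k : ℕ, 1 ≤ k → regularity (I ^ k) ≤ regularity (symbolicPower I k)) := by
  rcases hI with rfl | ⟨hmon, P, hP, hPI⟩
  · refine ⟨fun _ => HasNoEmbeddedPrimes.of_isRadical Ideal.isPrime_bot.isRadical,
      fun _ k hk => ?_⟩
    -- For the zero ideal both sides are the regularity of `⊥`; `1 ≤ k` matters because `⊥ ^ 0 = ⊤`.
    rw [symbolicPower_bot hk, Ideal.bot_pow (by omega)]
  · have hspan := hmon.eq_span_minimalExponents
    constructor
    · intro h
      rw [hspan]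
      exact HasNoEmbeddedPrimes.of_isRadical (isRadical_span_squarefree h.2)
    · intro h k _
      obtain ⟨a, ha⟩ := hP.nonempty
      obtain ⟨u, -, hu⟩ := hP.finite.exists_le_maximal ha
      rw [hPI] at hspan
      rw [hspan] at h ⊢
      exact hP.hasExchange.regularity_pow_le_symbolicPower (hP.finite.subset fun _ hw => hw.1)
        ⟨u, hu⟩ (fun v hv => hP.degree_eq hu hv) h k
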